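/- **Theorem (instability of the periodic orbit $13223122$).** Let $r\in\,]0,1[$ and $\alpha=(1+r)/2$. Consider four identical inelastic point particles on the line with restitution coefficient $r$. Write $p\in(\mathbb R_+)^3$ for the gaps between consecutive particles and $q\in\mathbb R^3$ for the relative velocities of consecutive particles. Collisions of the pairs 1-2, 2-3, 3-4 are called of type $\mathfrak a,\mathfrak b,\mathfrak c$, and act on $q$ by $$A=\begin{pmatrix}-r&0&0\\ \alpha&1&0\\0&0&1\end{pmatrix},\quad B=\begin{pmatrix}1&\alpha&0\\0&-r&0\\0&\alpha&1\end{pmatrix},\quad C=\begin{pmatrix}1&0&0\\0&1&\alpha\\0&0&-r\end{pmatrix}.$$ Only the plane $\mathrm{Span}[p,q]$ is recorded, through a unit normal vector $u=(x,y,z)$, where $u$ and $-u$ represent the same plane. Let $$X=\{|u|=1\}\cap\big(\{x\ge0,\ z\le0\}\cup\{x\le0,\ z\ge0\}\big),$$ and let $\widehat{\mathfrak P}_r$, with domain $X$, be the $\mathfrak b$-to-$\mathfrak b$ mapping. It sends the plane just after a collision of type $\mathfrak b$ to the plane just after the next collision of type $\mathfrak b$; for each collision on the way, with matrix $K\in\{A,B,C\}$,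 the plane is replaced by its image under $K$. Its value is the unit normal vector in $\{x\ge0,z\le0\}$. Explicitly, taking the representative of $u$ with $x\ge0,z\le0$, the collisions are * $\mathfrak{ab}$ (symbol $1$) if $y>0$ and $\alpha y-x>0$; * $\mathfrak{cb}$ (symbol $3$) if $y<0$ and $\alpha y-z<0$; * $\mathfrak{acb}$ or $\mathfrak{cab}$ (symbol $2$) otherwise. By convention this includes the limit cases $\alpha y=x$ or $\alpha y=z$ with a triple collision. A point $u\in X$ *generates the periodic orbit $13223122$* if the symbols of $u,\widehat{\mathfrak P}_r(u),\dots,\widehat{\mathfrak P}_r^{\,7}(u)$ are $1,3,2,2,3,1,2,2$ and $\widehat{\mathfrak P}_r^{\,8}(u)=\pm u$. The orbit of $u$ is *Lyapunov stable* if for every $\varepsilon>0$ there is $\delta>0$ such that $|\widehat{\mathfrak P}_r^{\,n}(v)-\widehat{\mathfrak P}_r^{\,n}(u)|<\varepsilon$ for all $n\ge0$ and all $v\in X$ with $|v-u|<\delta$. It is *locally attracting* if there is $\delta>0$ such that $|\widehat{\mathfrak P}_r^{\,n}(v)-\widehat{\mathfrak P}_r^{\,n}(u)|\to0$ as $n\to\infty$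 for all $v\in X$ with $|v-u|<\delta$. Then, for every $r\in\,]0,1[$, no point of $X$ generates the periodic orbit $13223122$ in a stable manner: if $u\in X$ generates it, then the orbit of $u$ is neither Lyapunov stable nor locally attracting. In particular it is not asymptotically stable. -/

import Mathlib

namespace FourParticles

/-!
Four identical inelastic point particles on the line, with restitution coefficient `r`.
The pairs 1-2, 2-3, 3-4 are indexed by `0, 1, 2 : Fin 3`; a collision of the pair `0`, `1`, `2`
is a collision of type a, b, c, respectively. A configuration is described by the gaps `p` and the
relative velocities `q` in `ℝ³`, and only the oriented plane spanned by `p` and `q` matters; it is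
encoded by its normal vector `q ∧ p`.
-/

/-- The constant `α = (1 + r) / 2`. -/
noncomputable def alpha (r : ℝ) : ℝ := (r + 1) / 2

/-- The collision matrices `A`, `B`, `C`: the action of a collision of type a, b, c on the
relative velocities. -/
noncomputable def collisionMatrix (r : ℝ) : Fin 3 → Matrix (Fin 3) (Fin 3) ℝ :=
  ![!![-r, 0, 0; alpha r, 1, 0; 0, 0, 1],
    !![1, alpha r, 0; 0, -r, 0; 0, alpha r, 1],
    !![1, 0, 0; 0, 1, alpha r; 0, 0, -r]]

/-- Effect of a collision of the pair `k` on the normal vector of the plane `Span[p, q]`.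
At the collision the plane is `Span[p', q]`, where `p'` has zero `k`-th entry and is therefore
fixed by the collision matrix `K`; the new plane `Span[p', K q]` is the image of the old one
under `K`. Since `(K q) ∧ (K p') = (adjugate K)ᵀ (q ∧ p')`, its oriented normal vector is the
following one. -/
noncomputable def collide (r : ℝ) (k : Fin 3) (u : Fin 3 → ℝ) : Fin 3 → ℝ :=
  (collisionMatrix r k).adjugate.transpose.mulVec u

/-- One cycle from a collision of type b to the next one, starting from the plane with normal
vector `u`: the list of the collisions, and the normal vector at the end of the cycle.
If the pair `k` has just collided, then with `e` the `k`-th basis vector, `p = u ∧ e`,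
`q = p ∧ u` and `v = u - (u ⬝ e) e` one has `q ⬝ v = - (u ⬝ e) * |v| ^ 2`. The sign of `u ⬝ e`,
that is, of the `k`-th entry of `u`, therefore decides which of the two other pairs collides
next: after b, the next collision is a if `0 < u 1` and c if `u 1 < 0`; after a, it is b if
`u 0 < 0` and c if `0 < u 0`; after c, it is b if `0 < u 2` and a if `u 2 < 0`. When the second
collision is not of type b, the third one is. In the limit cases where the sign is zero
(a and c simultaneous, or a triple collision), both a and c take place before b. -/
noncomputable def bBlock (r : ℝ) (u : Fin 3 → ℝ) : List (Fin 3) × (Fin 3 → ℝ) :=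
  if u 1 < 0 then
    if 0 < collide r 2 u 2 then ([2, 1], collide r 1 (collide r 2 u))
    else ([2, 0, 1], collide r 1 (collide r 0 (collide r 2 u)))
  else
    if collide r 0 u 0 < 0 then ([0, 1], collide r 1 (collide r 0 u))
    else ([0, 2, 1], collide r 1 (collide r 2 (collide r 0 u)))

/-- The domain `X` of the b-to-b mapping: the part of the unit sphere of `ℝ³` where `x ≥ 0, z ≤ 0`
or `x ≤ 0, z ≥ 0`. -/
def X : Set (EuclideanSpace ℝ (Fin 3)) :=
  {u | ‖u‖ = 1 ∧ ((0 ≤ u 0 ∧ u 2 ≤ 0) ∨ (u 0 ≤ 0 ∧ 0 ≤ u 2))}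

open Classical in
/-- The vectors `u` and `-u` define the same plane; the representative in `x ≥ 0, z ≤ 0`
of a point of `X`. -/
noncomputable def rep (u : EuclideanSpace ℝ (Fin 3)) : Fin 3 → ℝ :=
  if 0 ≤ u 0 ∧ u 2 ≤ 0 then u.ofLp else (-u).ofLp

/-- The b-to-b mapping on `X`, acting on unit normal vectors of planes. -/
noncomputable def bToB (r : ℝ) (u : EuclideanSpace ℝ (Fin 3)) : EuclideanSpace ℝ (Fin 3) :=
  let w : EuclideanSpace ℝ (Fin 3) := WithLp.toLp 2 (bBlock r (rep u)).2
  ‖w‖⁻¹ • w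

/-- The symbol of the cycle that starts at `u`: `1` for the collisions ab, `3` for cb,
and `2` for acb or cab. -/
noncomputable def symbol (r : ℝ) (u : EuclideanSpace ℝ (Fin 3)) : ℕ :=
  if (bBlock r (rep u)).1 = [0, 1] then 1
  else if (bBlock r (rep u)).1 = [2, 1] then 3
  else 2

/-- `u` generates the periodic orbit with pattern `w`: the successive cycles of the orbit of `u`
have the symbols of `w`, after which the initial plane is reached again. -/
def Generates (r : ℝ) (w : List ℕ) (u : EuclideanSpace ℝ (Fin 3)) : Prop :=
  (∀ k (hk : k < w.length), symbol r ((bToB r)^[k] u) = w[k]) ∧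
    ((bToB r)^[w.length] u = u ∨ (bToB r)^[w.length] u = -u)

/-- The orbit of `u` is stable in the sense of Lyapunov. -/
def LyapunovStable (r : ℝ) (u : EuclideanSpace ℝ (Fin 3)) : Prop :=
  ∀ ε > 0, ∃ δ > 0, ∀ v ∈ X, dist v u < δ →
    ∀ n : ℕ, dist ((bToB r)^[n] v) ((bToB r)^[n] u) < ε

/-- The orbit of `u` attracts the orbits of all the points of `X` close to `u`. -/
def LocallyAttracting (r : ℝ) (u : EuclideanSpace ℝ (Fin 3)) : Prop :=
  ∃ δ > 0, ∀ v ∈ X, dist v u < δ →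
    Filter.Tendsto (fun n : ℕ => dist ((bToB r)^[n] v) ((bToB r)^[n] u)) Filter.atTop (nhds 0)

end FourParticles

/-!
The left-right reflection exchanges the symbols 1 and 3, hence the words 1322 and 3122, so the
linear map of the whole period is the square of a half-period map `H`: the cycles 1, 3, 2, 2
followed by the reflection. If `v` generates the orbit and `H² v = λ v`, then `√λ v + H v` is an
eigenvector of `H` with eigenvalue `μ = √λ`, and it still satisfies the linear inequalities that
express the first three symbols. These inequalities force `κ = (1 - r)² / (2 r) > 2` and
`μ ≤ r⁷ κ`, so that `μ²` plus the linear coefficient of the characteristic polynomial of `H` is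
negative. The two other eigenvalues of `H` are then real, and one of them is less than `-μ`; its
left eigenvector is a functional that `H²` expands by a factor larger than `λ`.

An orbit that follows the periodic one closely has the same symbols, even if the periodic orbit
meets a discontinuity, because there the other branch has a distant image. Along such an orbit the
functional grows relative to the norm of the normal vector, so it must vanish. By Baire's theorem
there are points arbitrarily close to the periodic one whose orbits avoid its kernel.
-/

namespace FourParticles

open Filter Function Matrix Set Topology

section SpectralCriterion

lemma exists_cubic_root_lt_neg {a b c m : ℝ} (hm : m ^ 3 + a * m ^ 2 + b * m + c = 0)
    (hb : m ^ 2 + b < 0) : ∃ t < -m, t ^ 3 + a * t ^ 2 + b * t + c = 0 := by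
  -- The cubic is `(t - m) * Q t` with `Q` monic quadratic and `Q (-m) = m ^ 2 + b`.
  have hdisc : (m - a) ^ 2 < (a + m) ^ 2 - 4 * (b + m * (a + m)) := by linarith
  have hroot := Real.sq_sqrt ((sq_nonneg (m - a)).trans hdisc.le)
  have hlt := Real.lt_sqrt_of_sq_lt hdisc
  set s := √((a + m) ^ 2 - 4 * (b + m * (a + m)))
  refine ⟨(-(a + m) - s) / 2, by linarith, ?_⟩
  linear_combination hm + ((-(a + m) - s) / 2 - m) / 4 * hroot

lemma det_smul_one_sub_fin_three {R : Type*} [CommRing R] (M : Matrix (Fin 3) (Fin 3) R) (t : R) :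
    (t • 1 - M).det = t ^ 3 + -M.trace * t ^ 2 + M.adjugate.trace * t + -M.det := by
  simp [det_fin_three, trace_fin_three, adjugate_fin_three]
  ring

lemma exists_vecMul_eq_smul_lt_neg {M : Matrix (Fin 3) (Fin 3) ℝ} {v : Fin 3 → ℝ} {m : ℝ}
    (hv : v ≠ 0) (hMv : M *ᵥ v = m • v) (hneg : m ^ 2 + M.adjugate.trace < 0) :
    ∃ t < -m, ∃ l ≠ 0, l ᵥ* M = t • l := by
  have hdet : (m • 1 - M).det = 0 :=
    exists_mulVec_eq_zero_iff.1 ⟨v, hv, by rw [sub_mulVec, smul_mulVec, one_mulVec, hMv, sub_self]⟩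
  rw [det_smul_one_sub_fin_three] at hdet
  obtain ⟨t, ht, hroot⟩ := exists_cubic_root_lt_neg hdet hneg
  rw [← det_smul_one_sub_fin_three] at hroot
  obtain ⟨l, hl, hlM⟩ := exists_vecMul_eq_zero_iff.2 hroot
  rw [vecMul_sub, vecMul_smul, vecMul_one, sub_eq_zero] at hlM
  exact ⟨t, ht, l, hl, hlM.symm⟩

end SpectralCriterion

section CycleMatrices

/-- The matrix of a cycle of the b-to-b mapping, acting on normal vectors. The cycles ab, acb
(or cab) and cb, which have the symbols 1, 2 and 3, are indexed by `0`, `1` and `2`. -/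
noncomputable def blockMatrix (r : ℝ) : Fin 3 → Matrix (Fin 3) (Fin 3) ℝ :=
  ![!![-r, r * alpha r, 0; -alpha r, alpha r ^ 2 - r, r * alpha r; 0, 0, r ^ 2],
    !![r ^ 2, -(r ^ 2 * alpha r), 0;
      r * alpha r, r ^ 2 - 2 * r * alpha r ^ 2, r * alpha r; 0, -(r ^ 2 * alpha r), r ^ 2],
    !![r ^ 2, 0, 0; r * alpha r, alpha r ^ 2 - r, -alpha r; 0, r * alpha r, -r]]

/-- The index of the cycle that starts at the plane with normal vector `v`, where `v` is taken in
the cone `x ≥ 0`, `z ≤ 0`. -/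
noncomputable def cycle (r : ℝ) (v : Fin 3 → ℝ) : Fin 3 :=
  if v 0 < alpha r * v 1 then 0 else if alpha r * v 1 < v 2 then 2 else 1

/-- The cone `x ≥ 0`, `z ≤ 0` from which the representatives of planes are taken. -/
def Cone (v : Fin 3 → ℝ) : Prop := 0 ≤ v 0 ∧ v 2 ≤ 0

variable {r : ℝ} {v : Fin 3 → ℝ}

lemma alpha_pos (hr : 0 < r) : 0 < alpha r := by unfold alpha; linarith

lemma lt_alpha_sq (hr : r < 1) : r < alpha r ^ 2 := by
  have : 0 < (1 - r) ^ 2 := pow_pos (sub_pos.2 hr) 2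
  unfold alpha
  linarith

lemma collide_zero (r : ℝ) (v : Fin 3 → ℝ) :
    collide r 0 v = ![v 0 - alpha r * v 1, -r * v 1, -r * v 2] := by
  ext i
  fin_cases i <;> simp [collide, collisionMatrix, adjugate_fin_three, mulVec_eq_sum,
    Fin.sum_univ_three] <;> ring

lemma collide_one (r : ℝ) (v : Fin 3 → ℝ) :
    collide r 1 v = ![-r * v 0, -alpha r * v 0 + v 1 - alpha r * v 2, -r * v 2] := by
  ext i
  fin_cases i <;> simp [collide, collisionMatrix, adjugate_fin_three, mulVec_eq_sum,
    Fin.sum_univ_three] <;> ring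

lemma collide_two (r : ℝ) (v : Fin 3 → ℝ) :
    collide r 2 v = ![-r * v 0, -r * v 1, v 2 - alpha r * v 1] := by
  ext i
  fin_cases i <;> simp [collide, collisionMatrix, adjugate_fin_three, mulVec_eq_sum,
    Fin.sum_univ_three] <;> ring

lemma blockMatrix_zero_mulVec (r : ℝ) (v : Fin 3 → ℝ) : blockMatrix r 0 *ᵥ v =
    ![r * (alpha r * v 1 - v 0),
      alpha r * (alpha r * v 1 - v 0) - r * v 1 + r * alpha r * v 2, r ^ 2 * v 2] := by
  ext i
  fin_cases i <;> simp [blockMatrix, mulVec_eq_sum, Fin.sum_univ_three] <;> ring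

lemma blockMatrix_one_mulVec (r : ℝ) (v : Fin 3 → ℝ) : blockMatrix r 1 *ᵥ v =
    ![r ^ 2 * (v 0 - alpha r * v 1),
      r ^ 2 * v 1 + r * alpha r * (v 0 + v 2 - 2 * (alpha r * v 1)),
      r ^ 2 * (v 2 - alpha r * v 1)] := by
  ext i
  fin_cases i <;> simp [blockMatrix, mulVec_eq_sum, Fin.sum_univ_three] <;> ring

lemma blockMatrix_two_mulVec (r : ℝ) (v : Fin 3 → ℝ) : blockMatrix r 2 *ᵥ v =
    ![r ^ 2 * v 0, r * alpha r * v 0 - r * v 1 + alpha r * (alpha r * v 1 - v 2),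
      r * (alpha r * v 1 - v 2)] := by
  ext i
  fin_cases i <;> simp [blockMatrix, mulVec_eq_sum, Fin.sum_univ_three] <;> ring

lemma det_blockMatrix_ne_zero (hr : 0 < r) (s : Fin 3) : (blockMatrix r s).det ≠ 0 := by
  have h4 : (blockMatrix r 0).det = r ^ 4 := by simp [blockMatrix, det_fin_three]; ring
  have h6 : (blockMatrix r 1).det = r ^ 6 := by simp [blockMatrix, det_fin_three]; ring
  have h4' : (blockMatrix r 2).det = r ^ 4 := by simp [blockMatrix, det_fin_three]; ring
  fin_cases s
  · exact h4 ▸ (pow_pos hr 4).ne'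
  · exact h6 ▸ (pow_pos hr 6).ne'
  · exact h4' ▸ (pow_pos hr 4).ne'

lemma cycle_eq_zero_iff : cycle r v = 0 ↔ v 0 < alpha r * v 1 := by
  unfold cycle; split_ifs <;> simp_all

lemma cycle_eq_one_iff :
    cycle r v = 1 ↔ alpha r * v 1 ≤ v 0 ∧ v 2 ≤ alpha r * v 1 := by
  unfold cycle; split_ifs <;> simp_all

lemma Cone.cycle_eq_two_iff (hv : Cone v) : cycle r v = 2 ↔ alpha r * v 1 < v 2 := by
  have h : alpha r * v 1 < v 2 → ¬ v 0 < alpha r * v 1 := fun h => by linarith [hv.1, hv.2]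
  unfold cycle
  split_ifs <;> simp_all

lemma cycle_smul (r : ℝ) {c : ℝ} (hc : 0 < c) (v : Fin 3 → ℝ) : cycle r (c • v) = cycle r v := by
  simp only [cycle, Pi.smul_apply, smul_eq_mul, mul_left_comm _ c, mul_lt_mul_iff_right₀ hc]

lemma Cone.smul (hv : Cone v) {c : ℝ} (hc : 0 ≤ c) : Cone (c • v) :=
  ⟨mul_nonneg hc hv.1, mul_nonpos_of_nonneg_of_nonpos hc hv.2⟩

lemma Cone.blockMatrix_mulVec (hr : 0 < r) (hv : Cone v) {s : Fin 3} (hs : cycle r v = s) :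
    Cone (blockMatrix r s *ᵥ v) := by
  match s, hs with
  | 0, hs =>
    rw [blockMatrix_zero_mulVec]
    exact ⟨mul_nonneg hr.le (sub_nonneg.2 (cycle_eq_zero_iff.1 hs).le),
      mul_nonpos_of_nonneg_of_nonpos (sq_nonneg r) hv.2⟩
  | 1, hs =>
    rw [blockMatrix_one_mulVec]
    exact ⟨mul_nonneg (sq_nonneg r) (sub_nonneg.2 (cycle_eq_one_iff.1 hs).1),
      mul_nonpos_of_nonneg_of_nonpos (sq_nonneg r) (sub_nonpos.2 (cycle_eq_one_iff.1 hs).2)⟩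
  | 2, hs =>
    rw [blockMatrix_two_mulVec]
    exact ⟨mul_nonneg (sq_nonneg r) hv.1,
      mul_nonpos_of_nonneg_of_nonpos hr.le (sub_nonpos.2 (hv.cycle_eq_two_iff.1 hs).le)⟩

lemma bBlock_of_cycle_eq_zero (hr : 0 < r) (hv : Cone v) (h : cycle r v = 0) :
    bBlock r v = ([0, 1], blockMatrix r 0 *ᵥ v) := by
  have hx := cycle_eq_zero_iff.1 h
  have hy : 0 < v 1 := pos_of_mul_pos_right (hv.1.trans_lt hx) (alpha_pos hr).le
  have hcollide : collide r 0 v 0 < 0 := by rw [collide_zero]; exact sub_neg.2 hx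
  rw [bBlock, if_neg hy.not_gt, if_pos hcollide, collide_one, collide_zero,
    blockMatrix_zero_mulVec]
  simp only [cons_val]
  ring_nf

lemma bBlock_of_cycle_eq_one (h : cycle r v = 1) :
    bBlock r v = ([2, 0, 1], blockMatrix r 1 *ᵥ v) ∨
      bBlock r v = ([0, 2, 1], blockMatrix r 1 *ᵥ v) := by
  obtain ⟨hx, hz⟩ := cycle_eq_one_iff.1 h
  rw [bBlock]
  split_ifs with hy h0 h0
  · simp only [collide_two, cons_val] at h0
    linarith
  · left
    rw [collide_one, collide_zero, collide_two, blockMatrix_one_mulVec]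
    simp only [cons_val]
    ring_nf
  · simp only [collide_zero, cons_val] at h0
    linarith
  · right
    rw [collide_one, collide_two, collide_zero, blockMatrix_one_mulVec]
    simp only [cons_val]
    ring_nf

lemma bBlock_of_cycle_eq_two (hr : 0 < r) (hv : Cone v) (h : cycle r v = 2) :
    bBlock r v = ([2, 1], blockMatrix r 2 *ᵥ v) := by
  have hz := hv.cycle_eq_two_iff.1 h
  have hy : v 1 < 0 := neg_of_mul_neg_right (hz.trans_le hv.2) (alpha_pos hr).le
  have hcollide : 0 < collide r 2 v 2 := by rw [collide_two]; exact sub_pos.2 hz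
  rw [bBlock, if_pos hy, if_pos hcollide, collide_one, collide_two, blockMatrix_two_mulVec]
  simp only [cons_val]
  ring_nf

lemma Cone.bBlock_snd (hr : 0 < r) (hv : Cone v) :
    (bBlock r v).2 = blockMatrix r (cycle r v) *ᵥ v := by
  generalize hs : cycle r v = s
  match s, hs with
  | 0, hs => rw [bBlock_of_cycle_eq_zero hr hv hs]
  | 1, hs => rcases bBlock_of_cycle_eq_one hs with h | h <;> rw [h]
  | 2, hs => rw [bBlock_of_cycle_eq_two hr hv hs]

end CycleMatrices

section Mirror

/-- The left-right reflection of the line, acting on normal vectors. It exchanges the collisions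
of type a and c, hence the cycles with symbols 1 and 3. -/
def mirror : Matrix (Fin 3) (Fin 3) ℝ := !![0, 0, -1; 0, -1, 0; -1, 0, 0]

variable {r : ℝ} {v : Fin 3 → ℝ}

lemma mirror_mulVec_eq (v : Fin 3 → ℝ) : mirror *ᵥ v = ![-v 2, -v 1, -v 0] := by
  ext i
  fin_cases i <;> simp [mirror, mulVec_eq_sum, Fin.sum_univ_three]

lemma mirror_mulVec_mirror_mulVec (v : Fin 3 → ℝ) : mirror *ᵥ (mirror *ᵥ v) = v := by
  ext i
  fin_cases i <;> simp [mirror_mulVec_eq]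

lemma mirror_mulVec_blockMatrix_mulVec (r : ℝ) (s : Fin 3) (v : Fin 3 → ℝ) :
    mirror *ᵥ (blockMatrix r s *ᵥ v) = blockMatrix r s.rev *ᵥ (mirror *ᵥ v) := by
  have h0 : mirror *ᵥ (blockMatrix r 0 *ᵥ v) = blockMatrix r 2 *ᵥ (mirror *ᵥ v) := by
    simp only [mirror_mulVec_eq, blockMatrix_zero_mulVec, blockMatrix_two_mulVec, cons_val]
    ring_nf
  have h1 : mirror *ᵥ (blockMatrix r 1 *ᵥ v) = blockMatrix r 1 *ᵥ (mirror *ᵥ v) := by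
    simp only [mirror_mulVec_eq, blockMatrix_one_mulVec, cons_val]
    ring_nf
  have h2 : mirror *ᵥ (blockMatrix r 2 *ᵥ v) = blockMatrix r 0 *ᵥ (mirror *ᵥ v) := by
    simp only [mirror_mulVec_eq, blockMatrix_zero_mulVec, blockMatrix_two_mulVec, cons_val]
    ring_nf
  fin_cases s
  exacts [h0, h1, h2]

lemma Cone.mirror_mulVec (hv : Cone v) : Cone (mirror *ᵥ v) := by
  rw [mirror_mulVec_eq]
  exact ⟨neg_nonneg.2 hv.2, neg_nonpos.2 hv.1⟩

lemma Cone.cycle_mirror_mulVec (hv : Cone v) : cycle r (mirror *ᵥ v) = (cycle r v).rev := by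
  obtain ⟨h0, h2⟩ := hv
  rw [mirror_mulVec_eq]
  simp only [cycle, cons_val, mul_neg, neg_lt_neg_iff]
  split_ifs <;> first | rfl | linarith

/-- Half of the periodic orbit with pattern 13223122: the cycles 1, 3, 2, 2 followed by the
reflection of the line, which exchanges 1322 and 3122. -/
noncomputable def halfMatrix (r : ℝ) : Matrix (Fin 3) (Fin 3) ℝ :=
  mirror * blockMatrix r 1 * blockMatrix r 1 * blockMatrix r 2 * blockMatrix r 0

lemma halfMatrix_mulVec (r : ℝ) (v : Fin 3 → ℝ) :
    halfMatrix r *ᵥ v = mirror *ᵥ (blockMatrix r 1 *ᵥ (blockMatrix r 1 *ᵥ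
      (blockMatrix r 2 *ᵥ (blockMatrix r 0 *ᵥ v)))) := by
  simp only [halfMatrix, mulVec_mulVec, Matrix.mul_assoc]

lemma halfMatrix_mulVec_halfMatrix_mulVec (r : ℝ) (v : Fin 3 → ℝ) :
    halfMatrix r *ᵥ (halfMatrix r *ᵥ v) =
      blockMatrix r 1 *ᵥ (blockMatrix r 1 *ᵥ (blockMatrix r 0 *ᵥ (blockMatrix r 2 *ᵥ
        (blockMatrix r 1 *ᵥ (blockMatrix r 1 *ᵥ (blockMatrix r 2 *ᵥ
          (blockMatrix r 0 *ᵥ v))))))) := by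
  simp only [halfMatrix_mulVec, mirror_mulVec_blockMatrix_mulVec, mirror_mulVec_mirror_mulVec,
    show (0 : Fin 3).rev = 2 from rfl, show (1 : Fin 3).rev = 1 from rfl,
    show (2 : Fin 3).rev = 0 from rfl]

end Mirror

section HalfPeriod

/-- The parameter `κ = (1 - r) ^ 2 / (2 r)`, in which the half-period matrix has small
coefficients. -/
noncomputable def kappa (r : ℝ) : ℝ := (1 - r) ^ 2 / (2 * r)

/-- The quantity whose positivity means that the first cycle from `v` is ab. -/
noncomputable def firstMargin (r : ℝ) (v : Fin 3 → ℝ) : ℝ := alpha r * v 1 - v 0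

/-- The quantity whose positivity means that the cycle ab from `v` is followed by cb. -/
noncomputable def secondMargin (r : ℝ) (v : Fin 3 → ℝ) : ℝ :=
  (blockMatrix r 0 *ᵥ v) 2 - alpha r * (blockMatrix r 0 *ᵥ v) 1

/-- The quantity whose nonnegativity means that the cycles ab, cb from `v` are not followed by
a third cycle ab. -/
noncomputable def thirdMargin (r : ℝ) (v : Fin 3 → ℝ) : ℝ :=
  (blockMatrix r 2 *ᵥ (blockMatrix r 0 *ᵥ v)) 0
    - alpha r * (blockMatrix r 2 *ᵥ (blockMatrix r 0 *ᵥ v)) 1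

/-- The cone cut out by the constraints on the first three symbols of the pattern 13223122 that
suffice for its instability. -/
noncomputable def admissibleCone (r : ℝ) : ConvexCone ℝ (Fin 3 → ℝ) where
  carrier := {v | v 2 ≤ 0 ∧ 0 < firstMargin r v ∧ 0 < secondMargin r v ∧ 0 ≤ thirdMargin r v}
  smul_mem' c hc v hv := by
    obtain ⟨h2, hfst, hsnd, htrd⟩ := hv
    refine ⟨mul_nonpos_of_nonneg_of_nonpos hc.le h2, ?_, ?_, ?_⟩
    · have h : firstMargin r (c • v) = c * firstMargin r v := by
        simp only [firstMargin, Pi.smul_apply, smul_eq_mul]; ring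
      exact h ▸ mul_pos hc hfst
    · have h : secondMargin r (c • v) = c * secondMargin r v := by
        simp only [secondMargin, mulVec_smul, Pi.smul_apply, smul_eq_mul]; ring
      exact h ▸ mul_pos hc hsnd
    · have h : thirdMargin r (c • v) = c * thirdMargin r v := by
        simp only [thirdMargin, mulVec_smul, Pi.smul_apply, smul_eq_mul]; ring
      exact h ▸ mul_nonneg hc.le htrd
  add_mem' v hv w hw := by
    refine ⟨add_nonpos hv.1 hw.1, ?_, ?_, ?_⟩
    · have h : firstMargin r (v + w) = firstMargin r v + firstMargin r w := by
        simp only [firstMargin, Pi.add_apply]; ring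
      exact h ▸ add_pos hv.2.1 hw.2.1
    · have h : secondMargin r (v + w) = secondMargin r v + secondMargin r w := by
        simp only [secondMargin, mulVec_add, Pi.add_apply]; ring
      exact h ▸ add_pos hv.2.2.1 hw.2.2.1
    · have h : thirdMargin r (v + w) = thirdMargin r v + thirdMargin r w := by
        simp only [thirdMargin, mulVec_add, Pi.add_apply]; ring
      exact h ▸ add_nonneg hv.2.2.2 hw.2.2.2

variable {r : ℝ} {v : Fin 3 → ℝ}

lemma kappa_pos (hr : r ∈ Ioo 0 1) : 0 < kappa r :=
  div_pos (pow_pos (sub_pos.2 hr.2) 2) (mul_pos two_pos hr.1)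

lemma mul_kappa_lt_half (hr : r ∈ Ioo 0 1) : r * kappa r < 1 / 2 := by
  have hrκ : r * kappa r = (1 - r) ^ 2 / 2 := by
    unfold kappa; field_simp [hr.1.ne']
  have : (1 - r) ^ 2 < 1 := pow_lt_one₀ (sub_nonneg.2 hr.2.le) (by linarith [hr.1]) two_ne_zero
  linarith

lemma thirdMargin_eq (hr : r ≠ 0) (v : Fin 3 → ℝ) :
    thirdMargin r v =
      r * (kappa r * (secondMargin r v - r ^ 2 * firstMargin r v) / 2 + r ^ 2 * v 2) := by
  simp only [thirdMargin, secondMargin, firstMargin, blockMatrix_two_mulVec,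
    blockMatrix_zero_mulVec, cons_val, kappa, alpha]
  field_simp
  ring

lemma halfMatrix_mulVec_two (hr : r ≠ 0) (v : Fin 3 → ℝ) :
    (halfMatrix r *ᵥ v) 2 = r ^ 5 *
      (kappa r * ((kappa r - 1) * secondMargin r v / 2
        - (kappa r + 1) * r ^ 2 * firstMargin r v / 2 + r ^ 2 * v 2) - secondMargin r v) := by
  simp only [halfMatrix_mulVec, mirror_mulVec_eq, secondMargin, firstMargin, blockMatrix_two_mulVec,
    blockMatrix_zero_mulVec, blockMatrix_one_mulVec, cons_val, kappa, alpha]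
  field_simp
  ring

lemma firstMargin_halfMatrix_mulVec (hr : r ≠ 0) (v : Fin 3 → ℝ) :
    firstMargin r (halfMatrix r *ᵥ v) - kappa r * (halfMatrix r *ᵥ v) 2 =
      r ^ 7 * (kappa r * firstMargin r v - v 2) := by
  simp only [halfMatrix_mulVec, mirror_mulVec_eq, firstMargin, blockMatrix_two_mulVec,
    blockMatrix_zero_mulVec, blockMatrix_one_mulVec, cons_val, kappa, alpha]
  field_simp
  ring

lemma trace_adjugate_halfMatrix (hr : r ≠ 0) :
    (halfMatrix r).adjugate.trace = r ^ 13 * kappa r *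
      (3 - kappa r ^ 2 + (kappa r - 2) * (kappa r + 1) * (1 - r * kappa r) / 4
        + (kappa r - 1) * r / 2) := by
  simp only [halfMatrix, mirror, blockMatrix, alpha, kappa, cons_val, cons_mul, vecMul_cons,
    head_cons, tail_cons, zero_smul, neg_smul, one_smul, neg_cons, neg_zero, neg_neg,
    Matrix.neg_empty, empty_vecMul, add_zero, zero_add, neg_sub, Matrix.empty_mul,
    Equiv.symm_apply_apply, smul_cons, smul_eq_mul, Matrix.smul_empty, mul_zero, add_cons,
    empty_add_empty, adjugate_fin_three, of_apply, cons_val', cons_val_fin_one, trace_fin_three]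
  field_simp
  ring

lemma two_lt_of_mul_two_sub_mul_eq {κ r b ξ ζ : ℝ} (hr : 0 < r) (hκ : 0 < κ) (hb : 0 < b)
    (hξ : 0 < ξ) (hζ : 0 ≤ ζ) (hle : 2 * r ^ 2 * ζ ≤ κ * (b - r ^ 2 * ξ))
    (h : b * (2 - κ) * (ξ + κ * ζ) =
      r ^ 2 * (2 * ζ ^ 2 * (1 - κ) - κ * ξ * (ξ + κ * ζ))) : 2 < κ := by
  by_contra! hκ2
  have hsum : 0 < ξ + κ * ζ := by positivity
  have hloss : 0 < κ * r ^ 2 * ξ * (ξ + κ * ζ) := by positivity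
  rcases le_or_gt 1 κ with hκ1 | hκ1
  · have hleft : 0 ≤ b * (2 - κ) * (ξ + κ * ζ) :=
      mul_nonneg (mul_nonneg hb.le (sub_nonneg.2 hκ2)) hsum.le
    have hright : 0 ≤ r ^ 2 * ζ ^ 2 * (κ - 1) := mul_nonneg (by positivity) (sub_nonneg.2 hκ1)
    linarith
  · have hζle : 2 * r ^ 2 * ζ ≤ κ * b := hle.trans
      (mul_le_mul_of_nonneg_left (sub_le_self b (by positivity)) hκ.le)
    have hright : 2 * r ^ 2 * ζ * (ζ * (1 - κ)) ≤ κ * b * (ζ * (1 - κ)) :=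
      mul_le_mul_of_nonneg_right hζle (mul_nonneg hζ (sub_nonneg.2 hκ1.le))
    have hleft : 0 ≤ b * (2 - κ) * ξ :=
      mul_nonneg (mul_nonneg hb.le (sub_nonneg.2 hκ2)) hξ.le
    have hgap : 0 ≤ b * κ * ζ := by positivity
    linarith

lemma two_lt_kappa_of_mem_admissibleCone {μ : ℝ} (hr : r ∈ Ioo 0 1)
    (hv : v ∈ admissibleCone r) (hμ : halfMatrix r *ᵥ v = μ • v) : 2 < kappa r := by
  obtain ⟨h2, hfst, hsnd, htrd⟩ := hv
  have hκ := kappa_pos hr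
  rw [thirdMargin_eq hr.1.ne'] at htrd
  have hthird := halfMatrix_mulVec_two hr.1.ne' v
  have hfirst := firstMargin_halfMatrix_mulVec hr.1.ne' v
  rw [hμ] at hthird hfirst
  simp only [firstMargin, Pi.smul_apply, smul_eq_mul] at hthird hfirst
  have htrd' := nonneg_of_mul_nonneg_right htrd hr.1
  refine two_lt_of_mul_two_sub_mul_eq (ζ := -v 2) hr.1 hκ hsnd hfst (neg_nonneg.2 h2)
    (by linarith) ?_
  have hr5 : r ^ 5 * (kappa r + 1) ≠ 0 := by have := hr.1; positivity
  -- Eliminate the eigenvalue between the two coordinates of the eigenvector equation.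
  refine mul_left_cancel₀ hr5 ?_
  simp only [firstMargin] at hthird ⊢
  linear_combination 2 * (alpha r * v 1 - v 0 - kappa r * v 2) * hthird
    - 2 * v 2 * hfirst

lemma eigenvalue_le_of_mem_admissibleCone {μ : ℝ} (hr : r ∈ Ioo 0 1)
    (hv : v ∈ admissibleCone r) (hμ : halfMatrix r *ᵥ v = μ • v) : μ ≤ r ^ 7 * kappa r := by
  have hκ := two_lt_kappa_of_mem_admissibleCone hr hv hμ
  obtain ⟨h2, hfst, -, -⟩ := hv
  have hfirst := firstMargin_halfMatrix_mulVec hr.1.ne' v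
  rw [hμ] at hfirst
  simp only [firstMargin, Pi.smul_apply, smul_eq_mul] at hfirst hfst
  have hsum : 0 < alpha r * v 1 - v 0 - kappa r * v 2 := by nlinarith
  refine le_of_mul_le_mul_right ?_ hsum
  have hgap : 0 ≤ r ^ 7 * ((kappa r ^ 2 - 1) * -v 2) :=
    mul_nonneg (pow_nonneg hr.1.le 7) (mul_nonneg (by nlinarith) (neg_nonneg.2 h2))
  linarith

lemma sq_add_trace_adjugate_halfMatrix_neg {μ : ℝ} (hr : r ∈ Ioo 0 1) (hκ : 2 < kappa r)
    (hμ : 0 ≤ μ) (hμle : μ ≤ r ^ 7 * kappa r) : μ ^ 2 + (halfMatrix r).adjugate.trace < 0 := by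
  have hneg : r * kappa r + (3 - kappa r ^ 2
      + (kappa r - 2) * (kappa r + 1) * (1 - r * kappa r) / 4 + (kappa r - 1) * r / 2) < 0 := by
    have hhalf := mul_kappa_lt_half hr
    have hr0 := hr.1
    nlinarith [mul_pos (sub_pos.2 hκ) (sub_pos.2 hhalf),
      mul_pos (mul_pos (sub_pos.2 hκ) (sub_pos.2 hκ)) (sub_pos.2 hhalf),
      mul_pos hr0 (sub_pos.2 hκ), mul_pos (mul_pos hr0 (sub_pos.2 hκ)) (sub_pos.2 hκ)]
  have hsq : μ ^ 2 ≤ (r ^ 7 * kappa r) ^ 2 := pow_le_pow_left₀ hμ hμle 2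
  have hfactor : 0 < r ^ 13 * kappa r := mul_pos (pow_pos hr.1 13) (kappa_pos hr)
  rw [trace_adjugate_halfMatrix hr.1.ne']
  linarith [mul_neg_of_pos_of_neg hfactor hneg]

lemma exists_expanding_functional {lam : ℝ} (hr : r ∈ Ioo 0 1) (hlam : 0 < lam)
    (hv : v ∈ admissibleCone r) (hHv : halfMatrix r *ᵥ v ∈ admissibleCone r)
    (hper : halfMatrix r *ᵥ (halfMatrix r *ᵥ v) = lam • v) :
    ∃ σ > lam, ∃ l ≠ 0, ∀ w, l ⬝ᵥ (halfMatrix r *ᵥ (halfMatrix r *ᵥ w)) = σ * (l ⬝ᵥ w) := by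
  have hμ : 0 < √lam := Real.sqrt_pos.2 hlam
  set p := √lam • v + halfMatrix r *ᵥ v with hp
  have hpmem : p ∈ admissibleCone r :=
    (admissibleCone r).add_mem ((admissibleCone r).smul_mem hμ hv) hHv
  have hp0 : p ≠ 0 := by
    intro h0
    simpa [h0, firstMargin] using hpmem.2.1
  have heig : halfMatrix r *ᵥ p = √lam • p := by
    rw [hp, mulVec_add, mulVec_smul, hper, smul_add, smul_smul, Real.mul_self_sqrt hlam.le,
      add_comm]
  obtain ⟨t, ht, l, hl, hlH⟩ := exists_vecMul_eq_smul_lt_neg hp0 heig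
    (sq_add_trace_adjugate_halfMatrix_neg hr (two_lt_kappa_of_mem_admissibleCone hr hpmem heig)
      hμ.le (eigenvalue_le_of_mem_admissibleCone hr hpmem heig))
  refine ⟨t ^ 2, ?_, l, hl, fun w => ?_⟩
  · nlinarith [Real.sq_sqrt hlam.le]
  · rw [dotProduct_mulVec, hlH, smul_dotProduct, dotProduct_mulVec, hlH, smul_dotProduct,
      smul_eq_mul, smul_eq_mul, sq, mul_assoc]

end HalfPeriod

section Itinerary

variable {α ι : Type*}

/-- The symbols visited by the orbit of `u` under `f` in its first `n` steps. -/
def itinerary (f : α → α) (code : α → ι) (n : ℕ) (u : α) : List ι :=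
  (List.range n).map fun k => code (f^[k] u)

/-- Points of `S` close to `w` whose images are close to `f w` have the code of `w`. Closeness of
the images is part of the notion because the code is often locally constant only in this sense:
the map may be discontinuous across the boundary of a piece. -/
def CodeStableAt [TopologicalSpace α] (f : α → α) (S : Set α) (code : α → ι) (w : α) : Prop :=
  ∀ᶠ v in 𝓝[S] w ⊓ comap f (𝓝 (f w)), code v = code w

lemma itinerary_succ (f : α → α) (code : α → ι) (n : ℕ) (u : α) :
    itinerary f code (n + 1) u = code u :: itinerary f code n (f u) := by
  simp only [itinerary, List.range_succ_eq_map, List.map_cons, List.map_map, iterate_zero_apply]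
  rfl

lemma nonpos_of_mul_le_of_le {g : α → α} {T : Set α} {a : α → ℝ} {c B : ℝ} (hc : 1 < c)
    (hT : MapsTo g T T) (hgrow : ∀ x ∈ T, c * a x ≤ a (g x)) (hB : ∀ x ∈ T, a x ≤ B) {x : α}
    (hx : x ∈ T) : a x ≤ 0 := by
  have hiter : ∀ j, c ^ j * a x ≤ a (g^[j] x) := by
    intro j
    induction j with
    | zero => simp
    | succ j ih =>
      rw [iterate_succ_apply', pow_succ', mul_assoc]
      exact (mul_le_mul_of_nonneg_left ih (zero_le_one.trans hc.le)).trans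
        (hgrow _ (hT.iterate j hx))
  by_contra! hpos
  obtain ⟨j, hj⟩ := pow_unbounded_of_one_lt (B / a x) hc
  exact ((hiter j).trans (hB _ (hT.iterate j hx))).not_gt ((div_lt_iff₀ hpos).1 hj)

variable [PseudoMetricSpace α] {f : α → α} {S : Set α} {code : α → ι} {u w : α} {n : ℕ}

lemma CodeStableAt.eventually_dist (h : CodeStableAt f S code w) :
    ∀ᶠ ε in 𝓝[>] (0 : ℝ), ∀ v ∈ S, dist v w < ε → dist (f v) (f w) < ε → code v = code w := by
  have hbasis := (Metric.nhdsWithin_basis_ball (x := w) (s := S)).inf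
    ((Metric.nhds_basis_ball (x := f w)).comap f)
  obtain ⟨⟨δ, δ'⟩, ⟨hδ, hδ'⟩, hball⟩ := hbasis.eventually_iff.1 h
  filter_upwards [Ioo_mem_nhdsGT (lt_min hδ hδ')] with ε hε v hvS hv hfv
  exact hball ⟨⟨hv.trans (hε.2.trans_le (min_le_left _ _)), hvS⟩,
    hfv.trans (hε.2.trans_le (min_le_right _ _))⟩

lemma eventually_itinerary_eq_of_codeStableAt
    (hstable : ∀ k < n, CodeStableAt f S code (f^[k] u)) (hS : MapsTo f S S) :
    ∀ᶠ ε in 𝓝[>] (0 : ℝ), ∀ v ∈ S, (∀ k, dist (f^[k] v) (f^[k] u) < ε) →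
      itinerary f code n v = itinerary f code n u := by
  filter_upwards [(finite_lt_nat n).eventually_all.2 fun k hk => (hstable k hk).eventually_dist]
    with ε hε v hv hclose
  refine List.map_congr_left fun k hk => ?_
  refine hε k (List.mem_range.1 hk) _ (hS.iterate k hv) (hclose k) ?_
  simpa only [iterate_succ_apply'] using hclose (k + 1)

end Itinerary

section PiecewiseProjective

variable {E ι : Type*} [NormedAddCommGroup E] [NormedSpace ℝ E] {f : E → E} {S : Set E}
  {A : ι → E →L[ℝ] E} {code : E → ι} {u w : E} {n : ℕ}

/-- The composition of linear maps along a word, whose first letter is applied first. -/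
def wordMap (A : ι → E →L[ℝ] E) : List ι → E →L[ℝ] E
  | [] => .id ℝ E
  | s :: l => (wordMap A l).comp (A s)

/-- A map of a set `S` of unit vectors to itself that is given on each of the pieces `code = s`
by a linear map `A s`, followed by the projection to the unit sphere. -/
structure IsPiecewiseProjective (f : E → E) (S : Set E) (A : ι → E →L[ℝ] E) (code : E → ι) :
    Prop where
  norm_eq_one : ∀ u ∈ S, ‖u‖ = 1
  mapsTo : MapsTo f S S
  eq_normalize : ∀ u ∈ S, f u = NormedSpace.normalize (A (code u) u)

lemma normalize_map_normalize (L : E →L[ℝ] E) (x : E) :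
    NormedSpace.normalize (L (NormedSpace.normalize x)) = NormedSpace.normalize (L x) := by
  rcases eq_or_ne x 0 with rfl | hx
  · rw [NormedSpace.normalize_zero_eq_zero]
  · nth_rw 2 [NormedSpace.normalize]
    rw [map_smul, NormedSpace.normalize_smul_of_pos (inv_pos.2 (norm_pos_iff.2 hx))]

lemma IsPiecewiseProjective.iterate_eq_normalize (h : IsPiecewiseProjective f S A code) (n : ℕ)
    (hu : u ∈ S) : f^[n] u = NormedSpace.normalize (wordMap A (itinerary f code n u) u) := by
  induction n generalizing u with
  | zero => exact (NormedSpace.normalize_eq_self_of_norm_eq_one (h.norm_eq_one u hu)).symm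
  | succ n ih =>
    rw [iterate_succ_apply, ih (h.mapsTo hu), itinerary_succ, wordMap,
      ContinuousLinearMap.comp_apply, ← normalize_map_normalize _ (A (code u) u),
      ← h.eq_normalize u hu]

lemma continuousAt_normalize {x : E} (hx : x ≠ 0) : ContinuousAt NormedSpace.normalize x :=
  (continuousAt_id.norm.inv₀ (norm_ne_zero_iff.2 hx)).smul continuousAt_id

lemma IsPiecewiseProjective.codeStableAt [Finite ι] (h : IsPiecewiseProjective f S A code)
    (hw : ∀ s ≠ code w,
      (∀ᶠ v in 𝓝[S] w, code v ≠ s) ∨ A s w ≠ 0 ∧ NormedSpace.normalize (A s w) ≠ f w) :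
    CodeStableAt f S code w := by
  have hne : ∀ s, ∀ᶠ v in 𝓝[S] w ⊓ comap f (𝓝 (f w)), s ≠ code w → code v ≠ s := by
    refine fun s => eventually_imp_distrib_left.2 fun hs => ?_
    rcases hw s hs with hs | ⟨h0, hs⟩
    · exact hs.filter_mono inf_le_left
    · obtain ⟨U, V, hU, hV, hwU, hwV, hUV⟩ := t2_separation hs
      have hbranch : ∀ᶠ v in 𝓝[S] w, NormedSpace.normalize (A s v) ∈ U := by
        refine Tendsto.eventually_mem ?_ (hU.mem_nhds hwU)
        exact ((continuousAt_normalize h0).comp (A s).continuous.continuousAt).mono_left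
          nhdsWithin_le_nhds
      have himage : ∀ᶠ v in comap f (𝓝 (f w)), f v ∈ V := tendsto_comap (hV.mem_nhds hwV)
      filter_upwards [hbranch.filter_mono inf_le_left, himage.filter_mono inf_le_right,
        (eventually_mem_nhdsWithin).filter_mono inf_le_left] with v hvU hvV hvS hcode
      rw [← hcode, ← h.eq_normalize v hvS] at hvU
      exact hUV.notMem_of_mem_left hvU hvV
  filter_upwards [eventually_all.2 hne] with v hv
  by_contra hcode
  exact hv _ hcode rfl

lemma IsPiecewiseProjective.exists_forall_tracking_eq_zero
    (h : IsPiecewiseProjective f S A code) (hper : f^[n] u = u)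
    (hstable : ∀ k < n, CodeStableAt f S code (f^[k] u)) {φ : E →L[ℝ] ℝ} {σ : ℝ}
    (hφ : ∀ v, φ (wordMap A (itinerary f code n u) v) = σ * φ v)
    (hσ : ‖wordMap A (itinerary f code n u) u‖ < |σ|) :
    ∃ ε > 0, ∀ v ∈ S, (∀ k, dist (f^[k] v) (f^[k] u) < ε) → φ v = 0 := by
  set L := wordMap A (itinerary f code n u)
  obtain ⟨q, hLq, hqσ⟩ := exists_between hσ
  have hq : 0 < q := (norm_nonneg _).trans_lt hLq
  obtain ⟨δ, hδ, hLδ⟩ := Metric.eventually_nhds_iff.1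
    (L.continuous.norm.continuousAt.eventually_lt_const hLq)
  obtain ⟨ε, ⟨hit, hεδ⟩, hε⟩ := ((eventually_itinerary_eq_of_codeStableAt hstable h.mapsTo).and
    (Ioo_mem_nhdsGT hδ)).and self_mem_nhdsWithin |>.exists
  let T := {v | v ∈ S ∧ ∀ k, dist (f^[k] v) (f^[k] u) < ε}
  have hT : MapsTo f^[n] T T := by
    refine fun v hv => ⟨h.mapsTo.iterate n hv.1, fun k => ?_⟩
    simpa only [iterate_add_apply, hper] using hv.2 (k + n)
  have hgrow : ∀ v ∈ T, |σ| / q * |φ v| ≤ |φ (f^[n] v)| := by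
    intro v hv
    have hLv : ‖L v‖ < q := hLδ ((hv.2 0).trans hεδ.2)
    have hL0 : 0 < ‖L v‖ := by
      have hnorm := h.norm_eq_one _ (h.mapsTo.iterate n hv.1)
      rw [h.iterate_eq_normalize n hv.1, hit v hv.1 hv.2,
        NormedSpace.norm_normalize_eq_one_iff] at hnorm
      exact norm_pos_iff.2 hnorm
    rw [h.iterate_eq_normalize n hv.1, hit v hv.1 hv.2, NormedSpace.normalize, map_smul, hφ,
      smul_eq_mul, abs_mul, abs_mul, abs_inv, abs_norm, div_mul_eq_mul_div, div_eq_inv_mul]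
    gcongr
  refine ⟨ε, hε, fun v hvS hv => ?_⟩
  have hbound : ∀ w ∈ T, |φ w| ≤ ‖φ‖ := fun w hw => by
    simpa [h.norm_eq_one w hw.1] using φ.le_opNorm w
  exact abs_nonpos_iff.1
    (nonpos_of_mul_le_of_le ((one_lt_div hq).2 hqσ) hT hgrow hbound ⟨hvS, hv⟩)

lemma IsPiecewiseProjective.exists_forall_not_eventually_dist_lt
    (h : IsPiecewiseProjective f S A code) (hn : 0 < n) (hper : f^[n] u = u)
    (hstable : ∀ k < n, CodeStableAt f S code (f^[k] u)) {φ : E →L[ℝ] ℝ} {σ : ℝ}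
    (hφ : ∀ v, φ (wordMap A (itinerary f code n u) v) = σ * φ v)
    (hσ : ‖wordMap A (itinerary f code n u) u‖ < |σ|) :
    ∃ ε > 0, ∀ v ∈ S, (∀ k, φ (f^[k] v) ≠ 0) →
      ¬ ∀ᶠ k in atTop, dist (f^[k] v) (f^[k] u) < ε := by
  obtain ⟨ε, hε, hzero⟩ := h.exists_forall_tracking_eq_zero hper hstable hφ hσ
  refine ⟨ε, hε, fun v hv hφv hev => ?_⟩
  obtain ⟨K, hK⟩ := eventually_atTop.1 hev
  refine hφv (n * K) (hzero _ (h.mapsTo.iterate _ hv) fun k => ?_)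
  have hdist := hK (k + n * K) ((Nat.le_mul_of_pos_left K hn).trans (Nat.le_add_left _ _))
  have hfixed : f^[n * K] u = u := by rw [iterate_mul, iterate_fixed hper]
  rwa [iterate_add_apply, iterate_add_apply f k (n * K) u, hfixed] at hdist

lemma surjective_wordMap (hA : ∀ s, Surjective (A s)) (l : List ι) : Surjective (wordMap A l) := by
  induction l with
  | nil => exact surjective_id
  | cons s l ih => exact ih.comp (hA s)

lemma IsPiecewiseProjective.map_iterate_normalize_ne_zero (h : IsPiecewiseProjective f S A code)
    {φ : E →L[ℝ] ℝ} {v : E} (hv : NormedSpace.normalize v ∈ S)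
    (hφ : ∀ l, φ (wordMap A l v) ≠ 0) (k : ℕ) : φ (f^[k] (NormedSpace.normalize v)) ≠ 0 := by
  rw [h.iterate_eq_normalize k hv, normalize_map_normalize, NormedSpace.normalize, map_smul]
  set w := wordMap A (itinerary f code k (NormedSpace.normalize v)) v
  have hw : φ w ≠ 0 := hφ _
  have hw0 : w ≠ 0 := fun h0 => hw (by rw [h0, map_zero])
  exact smul_ne_zero (inv_ne_zero (norm_ne_zero_iff.2 hw0)) hw

lemma dense_setOf_forall_wordMap_ne_zero [CompleteSpace E] [Countable ι]
    (hA : ∀ s, Surjective (A s)) {φ : E →L[ℝ] ℝ} (hφ : φ ≠ 0) :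
    Dense {v | ∀ l, φ (wordMap A l v) ≠ 0} := by
  rw [ofPred_forall]
  refine dense_iInter_of_isOpen (fun l => ?_) fun l => ?_
  · exact isOpen_ne_fun (φ.comp (wordMap A l)).continuous continuous_const
  · have hne : φ.comp (wordMap A l) ≠ 0 := fun h0 => hφ <| by
      ext v
      obtain ⟨w, rfl⟩ := surjective_wordMap hA l v
      exact DFunLike.congr_fun h0 w
    exact (dense_compl_singleton (0 : ℝ)).preimage
      ((φ.comp (wordMap A l)).isOpenMap_of_ne_zero hne)

end PiecewiseProjective

section ConeDynamics

/-- The b-to-b mapping on normal vectors in the cone, without the normalization. -/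
noncomputable def step (r : ℝ) (v : Fin 3 → ℝ) : Fin 3 → ℝ := blockMatrix r (cycle r v) *ᵥ v

variable {r : ℝ} {v : Fin 3 → ℝ}

lemma step_smul (r : ℝ) {c : ℝ} (hc : 0 < c) (v : Fin 3 → ℝ) : step r (c • v) = c • step r v := by
  rw [step, cycle_smul r hc, mulVec_smul, step]

lemma itinerary_step_smul (r : ℝ) {c : ℝ} (hc : 0 < c) (n : ℕ) (v : Fin 3 → ℝ) :
    itinerary (step r) (cycle r) n (c • v) = itinerary (step r) (cycle r) n v := by
  induction n generalizing v with
  | zero => rfl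
  | succ n ih => rw [itinerary_succ, itinerary_succ, cycle_smul r hc, step_smul r hc, ih]

lemma itinerary_step_succ_eq_cons_iff {n : ℕ} {s : Fin 3} {l : List (Fin 3)} :
    itinerary (step r) (cycle r) (n + 1) v = s :: l ↔
      cycle r v = s ∧ itinerary (step r) (cycle r) n (blockMatrix r s *ᵥ v) = l := by
  rw [itinerary_succ, List.cons.injEq, step]
  exact and_congr_right fun h => by rw [h]

lemma Cone.itinerary_step_mirror_mulVec (hr : 0 < r) (hv : Cone v) (n : ℕ) :
    itinerary (step r) (cycle r) n (mirror *ᵥ v) =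
      (itinerary (step r) (cycle r) n v).map Fin.rev := by
  induction n generalizing v with
  | zero => rfl
  | succ n ih =>
    rw [itinerary_succ, itinerary_succ, List.map_cons, step, hv.cycle_mirror_mulVec,
      ← mirror_mulVec_blockMatrix_mulVec, ih (hv.blockMatrix_mulVec hr rfl), step]

lemma Cone.mem_admissibleCone (hr : 0 < r) (hv : Cone v) {l : List (Fin 3)}
    (h : itinerary (step r) (cycle r) (l.length + 3) v = 0 :: 2 :: 1 :: l) :
    v ∈ admissibleCone r := by
  simp only [itinerary_step_succ_eq_cons_iff] at h
  obtain ⟨h0, h2, h1, -⟩ := h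
  have hfst := cycle_eq_zero_iff.1 h0
  have hsnd := (hv.blockMatrix_mulVec hr h0).cycle_eq_two_iff.1 h2
  exact ⟨hv.2, sub_pos.2 hfst, sub_pos.2 hsnd, sub_nonneg.2 (cycle_eq_one_iff.1 h1).1⟩

lemma Cone.halfMatrix_mulVec_mem_admissibleCone (hr : 0 < r) (hv : Cone v)
    (h : itinerary (step r) (cycle r) 8 v = [0, 2, 1, 1, 2, 0, 1, 1]) :
    halfMatrix r *ᵥ v ∈ admissibleCone r := by
  simp only [itinerary_step_succ_eq_cons_iff] at h
  obtain ⟨h0, h2, h1, h1', h2', h0', h1'', -⟩ := h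
  have hcone := (((hv.blockMatrix_mulVec hr h0).blockMatrix_mulVec hr h2).blockMatrix_mulVec hr
    h1).blockMatrix_mulVec hr h1'
  rw [halfMatrix_mulVec]
  refine hcone.mirror_mulVec.mem_admissibleCone hr (l := []) ?_
  have hit := (itinerary_step_succ_eq_cons_iff (n := 2)).2
    ⟨h2', itinerary_step_succ_eq_cons_iff.2 ⟨h0', itinerary_step_succ_eq_cons_iff.2 ⟨h1'', rfl⟩⟩⟩
  rw [List.length_nil, zero_add, hcone.itinerary_step_mirror_mulVec hr, hit]
  rfl

lemma ne_zero_of_cycle_eq_zero_of_cycle_eq_two (hr : r ∈ Ioo 0 1) (hv : Cone v)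
    (h0 : cycle r v = 0) (h2 : cycle r (blockMatrix r 0 *ᵥ v) = 2) : v 0 ≠ 0 ∨ v 2 ≠ 0 := by
  by_contra! hzero
  have hα := alpha_pos hr.1
  rw [(hv.blockMatrix_mulVec hr.1 h0).cycle_eq_two_iff, blockMatrix_zero_mulVec] at h2
  rw [cycle_eq_zero_iff, hzero.1] at h0
  simp only [hzero.1, hzero.2, cons_val] at h2
  have hgain := mul_pos (sub_pos.2 (lt_alpha_sq hr.2)) h0
  linarith

end ConeDynamics

section Regular

/-- The vectors that lie neither on the first nor on the third coordinate axis. On these axes the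
cycle acb has the same image as a neighbouring cycle ab or cb, so that the b-to-b mapping does not
separate the cycles. -/
def Regular (w : Fin 3 → ℝ) : Prop := w 1 ≠ 0 ∨ w 0 ≠ 0 ∧ w 2 ≠ 0

variable {r c : ℝ} {w : Fin 3 → ℝ}

lemma regular_mirror_mulVec_iff : Regular (mirror *ᵥ w) ↔ Regular w := by
  simp only [Regular, mirror_mulVec_eq, cons_val, ne_eq, neg_eq_zero]
  tauto

lemma Regular.smul (hw : Regular w) (hc : c ≠ 0) : Regular (c • w) :=
  hw.imp (smul_ne_zero hc) (And.imp (smul_ne_zero hc) (smul_ne_zero hc))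

lemma Cone.eq_zero_of_blockMatrix_one_mulVec (hr : r ∈ Ioo 0 1) (hw : Cone w)
    (h0 : (blockMatrix r 1 *ᵥ w) 0 = 0) (h1 : (blockMatrix r 1 *ᵥ w) 1 = 0) : w = 0 := by
  have hα := alpha_pos hr.1
  simp only [blockMatrix_one_mulVec, cons_val] at h0 h1
  have hx : w 0 = alpha r * w 1 := sub_eq_zero.1 ((mul_eq_zero_iff_left (pow_pos hr.1 2).ne').1 h0)
  have hy : 0 ≤ w 1 := nonneg_of_mul_nonneg_right (hx ▸ hw.1) hα
  have hbalance : (alpha r ^ 2 - r) * w 1 = alpha r * w 2 :=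
    mul_left_cancel₀ hr.1.ne' (by linear_combination r * alpha r * hx - h1)
  have hy0 : w 1 = 0 := by
    refine hy.antisymm' ((mul_nonpos_iff_pos_imp_nonpos.1 ?_).1 (sub_pos.2 (lt_alpha_sq hr.2)))
    exact hbalance ▸ mul_nonpos_of_nonneg_of_nonpos hα.le hw.2
  rw [hy0, mul_zero] at hx hbalance
  have hz0 : w 2 = 0 := (mul_eq_zero_iff_left hα.ne').1 hbalance.symm
  ext i
  fin_cases i
  exacts [hx, hy0, hz0]

lemma Cone.regular_blockMatrix_one_mulVec (hr : r ∈ Ioo 0 1) (hw : Cone w) (hw0 : w ≠ 0) :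
    Regular (blockMatrix r 1 *ᵥ w) := by
  by_contra h
  simp only [Regular, not_or, not_and_or, not_not] at h
  obtain ⟨h1, h0 | h2⟩ := h
  · exact hw0 (hw.eq_zero_of_blockMatrix_one_mulVec hr h0 h1)
  · have hmirror : mirror *ᵥ (blockMatrix r 1 *ᵥ w) = blockMatrix r 1 *ᵥ (mirror *ᵥ w) :=
      mirror_mulVec_blockMatrix_mulVec r 1 w
    have hzero : mirror *ᵥ w = 0 :=
      hw.mirror_mulVec.eq_zero_of_blockMatrix_one_mulVec hr
        (by rw [← hmirror, mirror_mulVec_eq]; exact neg_eq_zero.2 h2)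
        (by rw [← hmirror, mirror_mulVec_eq]; exact neg_eq_zero.2 h1)
    refine hw0 ?_
    rw [← mirror_mulVec_mirror_mulVec w, hzero, mulVec_zero]

lemma Cone.regular_of_cycle_eq_one (hr : r ∈ Ioo 0 1) (hw : Cone w) (hw0 : w ≠ 0)
    (h : cycle r (blockMatrix r 1 *ᵥ w) = 1) : Regular w := by
  by_contra hreg
  simp only [Regular, not_or, not_and_or, not_not] at hreg
  obtain ⟨hx, hz⟩ := cycle_eq_one_iff.1 h
  simp only [blockMatrix_one_mulVec, cons_val, hreg.1] at hx hz
  have hgap := mul_pos hr.1 (sub_pos.2 (lt_alpha_sq hr.2))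
  have hzero : w 0 = 0 ∧ w 2 = 0 := by
    rcases hreg.2 with h0 | h2
    · rw [h0] at hz
      refine ⟨h0, hw.2.antisymm (nonneg_of_mul_nonneg_right ?_ hgap)⟩
      linarith
    · rw [h2] at hx
      refine ⟨hw.1.antisymm' ((mul_nonpos_iff_pos_imp_nonpos.1 ?_).1 hgap), h2⟩
      linarith
  refine hw0 (funext fun i => ?_)
  fin_cases i
  exacts [hzero.1, hreg.1, hzero.2]

lemma Cone.blockMatrix_zero_mulVec_ne_smul (hr : 0 < r) (hw : Cone w) (hreg : Regular w)
    (h0 : alpha r * w 1 = w 0) (c : ℝ) :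
    blockMatrix r 0 *ᵥ w ≠ c • (blockMatrix r 1 *ᵥ w) := by
  have hα := alpha_pos hr
  have hy : 0 < w 1 := by
    refine (nonneg_of_mul_nonneg_right (h0 ▸ hw.1) hα).lt_of_ne' fun h1 => ?_
    rw [h1, mul_zero] at h0
    exact hreg.elim (· h1) (·.1 h0.symm)
  have hfactor : 0 < r ^ 3 * w 1 * (alpha r * w 1 - (1 + r) * w 2) := by
    have := mul_nonneg (by linarith : 0 ≤ 1 + r) (neg_nonneg.2 hw.2)
    have := mul_pos hα hy
    exact mul_pos (mul_pos (pow_pos hr 3) hy) (by linarith)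
  intro h
  rw [blockMatrix_zero_mulVec, blockMatrix_one_mulVec] at h
  have h1 := congrFun h 1
  have h2 := congrFun h 2
  simp only [cons_val, Pi.smul_apply, smul_eq_mul, ← h0] at h1 h2
  -- The first coordinate of the cross product of the two vectors.
  refine hfactor.ne ?_
  linear_combination (r ^ 2 * (alpha r * w 1 - w 2)) * h1
    + (r ^ 2 * w 1 + r * alpha r * (w 2 - alpha r * w 1)) * h2

lemma Cone.blockMatrix_two_mulVec_ne_smul (hr : 0 < r) (hw : Cone w) (hreg : Regular w)
    (h2 : alpha r * w 1 = w 2) (c : ℝ) :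
    blockMatrix r 2 *ᵥ w ≠ c • (blockMatrix r 1 *ᵥ w) := by
  intro h
  have h' : mirror *ᵥ (blockMatrix r 2 *ᵥ w) = mirror *ᵥ (c • (blockMatrix r 1 *ᵥ w)) := by rw [h]
  rw [mulVec_smul, mirror_mulVec_blockMatrix_mulVec, mirror_mulVec_blockMatrix_mulVec] at h'
  refine hw.mirror_mulVec.blockMatrix_zero_mulVec_ne_smul hr (regular_mirror_mulVec_iff.2 hreg) ?_
    c h'
  simp only [mirror_mulVec_eq, cons_val, mul_neg, h2]

end Regular

section Sphere

/-- The matrix `blockMatrix r s` as a continuous linear map. -/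
noncomputable def blockMap (r : ℝ) (s : Fin 3) :
    EuclideanSpace ℝ (Fin 3) →L[ℝ] EuclideanSpace ℝ (Fin 3) :=
  toEuclideanCLM (n := Fin 3) (𝕜 := ℝ) (blockMatrix r s)

/-- The index of the cycle that starts at the unit normal vector `u`, where `u` is taken in the
cone `x ≥ 0`, `z ≤ 0`. -/
noncomputable def code (r : ℝ) (u : EuclideanSpace ℝ (Fin 3)) : Fin 3 := cycle r u.ofLp

/-- The unit vectors of the cone `x ≥ 0`, `z ≤ 0`. -/
def sphereCone : Set (EuclideanSpace ℝ (Fin 3)) := {u | ‖u‖ = 1 ∧ Cone u.ofLp}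

variable {r δ : ℝ} {s : Fin 3} {u v w : EuclideanSpace ℝ (Fin 3)} {n : ℕ}

lemma ofLp_blockMap (r : ℝ) (s : Fin 3) (v : EuclideanSpace ℝ (Fin 3)) :
    (blockMap r s v).ofLp = blockMatrix r s *ᵥ v.ofLp :=
  ofLp_toEuclideanCLM _ _

lemma blockMap_injective (hr : 0 < r) (s : Fin 3) : Injective (blockMap r s) := by
  intro v w h
  have hofLp := congrArg WithLp.ofLp h
  rw [ofLp_blockMap, ofLp_blockMap] at hofLp
  exact WithLp.ofLp_injective 2 (mulVec_injective_of_isUnit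
    ((isUnit_iff_isUnit_det _).2 (det_blockMatrix_ne_zero hr s).isUnit) hofLp)

lemma blockMap_surjective (hr : 0 < r) (s : Fin 3) : Surjective (blockMap r s) :=
  LinearMap.injective_iff_surjective.1 (blockMap_injective hr s)

lemma ne_zero_of_mem_sphereCone (hu : u ∈ sphereCone) : u ≠ 0 :=
  norm_ne_zero_iff.1 (hu.1.trans_ne one_ne_zero)

lemma blockMap_ne_zero (hr : 0 < r) (s : Fin 3) (hv : v ≠ 0) : blockMap r s v ≠ 0 :=
  (map_ne_zero_iff _ (blockMap_injective hr s)).2 hv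

lemma rep_of_cone (hu : Cone u.ofLp) : rep u = u.ofLp := if_pos hu

lemma bToB_eq_normalize (hr : 0 < r) (hu : u ∈ sphereCone) :
    bToB r u = NormedSpace.normalize (blockMap r (code r u) u) := by
  have h : WithLp.toLp 2 (bBlock r (rep u)).2 = blockMap r (code r u) u := by
    rw [rep_of_cone hu.2, hu.2.bBlock_snd hr, code, ← ofLp_blockMap]
  simp only [bToB, h]
  rfl

lemma isPiecewiseProjective_bToB (hr : 0 < r) :
    IsPiecewiseProjective (bToB r) sphereCone (blockMap r) (code r) where
  norm_eq_one u hu := hu.1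
  mapsTo u hu := by
    have hcone := hu.2.blockMatrix_mulVec hr rfl
    rw [bToB_eq_normalize hr hu]
    refine ⟨NormedSpace.norm_normalize
      (blockMap_ne_zero hr _ (ne_zero_of_mem_sphereCone hu)), ?_⟩
    rw [NormedSpace.normalize, WithLp.ofLp_smul, ofLp_blockMap]
    exact hcone.smul (inv_nonneg.2 (norm_nonneg _))
  eq_normalize u hu := bToB_eq_normalize hr hu

lemma exists_ofLp_bToB_eq_smul_step (hr : 0 < r) (hu : u ∈ sphereCone) :
    ∃ c > (0 : ℝ), (bToB r u).ofLp = c • step r u.ofLp := by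
  have h0 := blockMap_ne_zero hr (code r u) (ne_zero_of_mem_sphereCone hu)
  refine ⟨_, inv_pos.2 (norm_pos_iff.2 h0), ?_⟩
  rw [bToB_eq_normalize hr hu, NormedSpace.normalize, WithLp.ofLp_smul, ofLp_blockMap, code, step]

lemma itinerary_bToB_eq_itinerary_step (hr : 0 < r) (hu : u ∈ sphereCone) :
    itinerary (bToB r) (code r) n u = itinerary (step r) (cycle r) n u.ofLp := by
  induction n generalizing u with
  | zero => rfl
  | succ n ih =>
    obtain ⟨c, hc, hstep⟩ := exists_ofLp_bToB_eq_smul_step hr hu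
    rw [itinerary_succ, itinerary_succ, ih ((isPiecewiseProjective_bToB hr).mapsTo hu), hstep,
      itinerary_step_smul r hc, code]

lemma normalize_blockMap_ne_bToB (hr : 0 < r) (hw : w ∈ sphereCone)
    (hs : ∀ c : ℝ, blockMatrix r s *ᵥ w.ofLp ≠ c • (blockMatrix r (code r w) *ᵥ w.ofLp)) :
    NormedSpace.normalize (blockMap r s w) ≠ bToB r w := by
  intro h
  rw [bToB_eq_normalize hr hw] at h
  refine hs (‖blockMap r s w‖ * ‖blockMap r (code r w) w‖⁻¹) ?_
  rw [← ofLp_blockMap, ← ofLp_blockMap, ← WithLp.ofLp_smul, mul_smul]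
  change _ = (‖blockMap r s w‖ • NormedSpace.normalize (blockMap r (code r w) w)).ofLp
  rw [← h, NormedSpace.norm_smul_normalize]

lemma codeStableAt_of_code_ne_one {f : EuclideanSpace ℝ (Fin 3) → EuclideanSpace ℝ (Fin 3)}
    (hw : w ∈ sphereCone) (h : code r w ≠ 1) : CodeStableAt f sphereCone (code r) w := by
  refine Eventually.filter_mono inf_le_left ?_
  generalize hs : code r w = s at h
  match s, hs with
  | 0, hs =>
    have hlt : ∀ᶠ v in 𝓝 w, v 0 < alpha r * v 1 :=
      ContinuousAt.eventually_lt (by fun_prop) (by fun_prop) (cycle_eq_zero_iff.1 hs)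
    filter_upwards [hlt.filter_mono nhdsWithin_le_nhds] with v hv
    exact cycle_eq_zero_iff.2 hv
  | 2, hs =>
    have hlt : ∀ᶠ v in 𝓝 w, alpha r * v 1 < v 2 :=
      ContinuousAt.eventually_lt (by fun_prop) (by fun_prop) (hw.2.cycle_eq_two_iff.1 hs)
    filter_upwards [hlt.filter_mono nhdsWithin_le_nhds, self_mem_nhdsWithin] with v hv hvS
    exact hvS.2.cycle_eq_two_iff.2 hv

lemma codeStableAt_bToB_of_regular (hr : 0 < r) (hw : w ∈ sphereCone) (hreg : Regular w.ofLp)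
    (h : code r w = 1) : CodeStableAt (bToB r) sphereCone (code r) w := by
  have hw0 := ne_zero_of_mem_sphereCone hw
  obtain ⟨hx, hz⟩ := cycle_eq_one_iff.1 h
  refine (isPiecewiseProjective_bToB hr).codeStableAt fun s hs => ?_
  rw [h] at hs
  match s with
  | 0 =>
    rcases hx.lt_or_eq with hx | hx
    · have hlt : ∀ᶠ v in 𝓝 w, alpha r * v 1 < v 0 :=
        ContinuousAt.eventually_lt (by fun_prop) (by fun_prop) hx
      left
      filter_upwards [hlt.filter_mono nhdsWithin_le_nhds] with v hv
      exact cycle_eq_zero_iff.not.2 hv.not_gt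
    · refine .inr ⟨blockMap_ne_zero hr 0 hw0, normalize_blockMap_ne_bToB hr hw ?_⟩
      exact h.symm ▸ hw.2.blockMatrix_zero_mulVec_ne_smul hr hreg hx
  | 2 =>
    rcases hz.lt_or_eq with hz | hz
    · have hlt : ∀ᶠ v in 𝓝 w, v 2 < alpha r * v 1 :=
        ContinuousAt.eventually_lt (by fun_prop) (by fun_prop) hz
      left
      filter_upwards [hlt.filter_mono nhdsWithin_le_nhds, self_mem_nhdsWithin] with v hv hvS
      exact hvS.2.cycle_eq_two_iff.not.2 hv.not_gt
    · refine .inr ⟨blockMap_ne_zero hr 2 hw0, normalize_blockMap_ne_bToB hr hw ?_⟩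
      exact h.symm ▸ hw.2.blockMatrix_two_mulVec_ne_smul hr hreg hz.symm

lemma codeStableAt_bToB_of_code_eq_one (hr : r ∈ Ioo 0 1) (hw : w ∈ sphereCone)
    (h : code r w = 1) (h' : code r (bToB r w) = 1) :
    CodeStableAt (bToB r) sphereCone (code r) w ∧
      CodeStableAt (bToB r) sphereCone (code r) (bToB r w) := by
  have hw0 : w.ofLp ≠ 0 := (WithLp.ofLp_eq_zero 2).not.2 (ne_zero_of_mem_sphereCone hw)
  obtain ⟨c, hc, hstep⟩ := exists_ofLp_bToB_eq_smul_step hr.1 hw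
  rw [step, ← code, h] at hstep
  have hreg' : Regular (bToB r w).ofLp :=
    hstep ▸ (hw.2.regular_blockMatrix_one_mulVec hr hw0).smul hc.ne'
  have hstable := codeStableAt_bToB_of_regular hr.1
    ((isPiecewiseProjective_bToB hr.1).mapsTo hw) hreg' h'
  rw [code, hstep, cycle_smul r hc] at h'
  exact ⟨codeStableAt_bToB_of_regular hr.1 hw (hw.2.regular_of_cycle_eq_one hr hw0 h') h, hstable⟩

lemma codeStableAt_iterate_of_itinerary (hr : r ∈ Ioo 0 1) (hu : u ∈ sphereCone)
    (h : itinerary (bToB r) (code r) 8 u = [0, 2, 1, 1, 2, 0, 1, 1]) {k : ℕ} (hk : k < 8) :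
    CodeStableAt (bToB r) sphereCone (code r) ((bToB r)^[k] u) := by
  have hmem : ∀ j, (bToB r)^[j] u ∈ sphereCone :=
    fun j => (isPiecewiseProjective_bToB hr.1).mapsTo.iterate j hu
  have hcodes : ∀ j (hj : j < 8), code r ((bToB r)^[j] u) =
      ([0, 2, 1, 1, 2, 0, 1, 1] : List (Fin 3))[j] := by
    intro j hj
    simp [← h, itinerary]
  have hother : ∀ j, code r ((bToB r)^[j] u) = 0 ∨ code r ((bToB r)^[j] u) = 2 →
      CodeStableAt (bToB r) sphereCone (code r) ((bToB r)^[j] u) :=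
    fun j hj => codeStableAt_of_code_ne_one (hmem j) (by rcases hj with hj | hj <;> simp [hj])
  have hpair : ∀ j, code r ((bToB r)^[j] u) = 1 → code r ((bToB r)^[j + 1] u) = 1 →
      CodeStableAt (bToB r) sphereCone (code r) ((bToB r)^[j] u) ∧
        CodeStableAt (bToB r) sphereCone (code r) ((bToB r)^[j + 1] u) := by
    intro j hj hj'
    rw [iterate_succ_apply'] at hj' ⊢
    exact codeStableAt_bToB_of_code_eq_one hr (hmem j) hj hj'
  have h23 := hpair 2 (hcodes 2 (by lia)) (hcodes 3 (by lia))
  have h67 := hpair 6 (hcodes 6 (by lia)) (hcodes 7 (by lia))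
  interval_cases k
  exacts [hother 0 (.inl (hcodes 0 (by lia))), hother 1 (.inr (hcodes 1 (by lia))), h23.1, h23.2,
    hother 4 (.inr (hcodes 4 (by lia))), hother 5 (.inl (hcodes 5 (by lia))), h67.1, h67.2]

lemma mem_closure_cone_interior (hu : Cone u.ofLp) :
    u ∈ closure {v : EuclideanSpace ℝ (Fin 3) | 0 < v 0 ∧ v 2 < 0} := by
  have hline : Tendsto (fun t : ℝ => u + t • !₂[(1 : ℝ), 0, -1]) (𝓝[>] 0) (𝓝 u) := by
    have hcont : Continuous fun t : ℝ => u + t • !₂[(1 : ℝ), 0, -1] := by fun_prop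
    exact (hcont.tendsto' 0 u (by simp)).mono_left nhdsWithin_le_nhds
  refine mem_closure_of_tendsto hline ?_
  filter_upwards [self_mem_nhdsWithin] with t ht
  have ht0 : 0 < t := ht
  have hx := hu.1
  have hz := hu.2
  constructor <;> simp <;> linarith

lemma exists_normalize_mem_sphereCone {D : Set (EuclideanSpace ℝ (Fin 3))} (hD : Dense D)
    (hu : u ∈ sphereCone) (hδ : 0 < δ) :
    ∃ v ∈ D, NormedSpace.normalize v ∈ sphereCone ∧ 0 < NormedSpace.normalize v 0 ∧
      dist (NormedSpace.normalize v) u < δ := by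
  have hopen : IsOpen {v : EuclideanSpace ℝ (Fin 3) | 0 < v 0 ∧ v 2 < 0} :=
    .and (isOpen_lt (by fun_prop) (by fun_prop)) (isOpen_lt (by fun_prop) (by fun_prop))
  have hfreq := mem_closure_iff_frequently.1
    (closure_minimal (hD.open_subset_closure_inter hopen) isClosed_closure
      (mem_closure_cone_interior hu.2))
  have hnear : ∀ᶠ v in 𝓝 u, dist (NormedSpace.normalize v) u < δ := by
    have hcont := continuousAt_normalize (ne_zero_of_mem_sphereCone hu)
    rw [ContinuousAt, NormedSpace.normalize_eq_self_of_norm_eq_one hu.1] at hcont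
    exact hcont.eventually (Metric.ball_mem_nhds u hδ)
  obtain ⟨v, ⟨⟨hx, hz⟩, hvD⟩, hvu⟩ := (hfreq.and_eventually hnear).exists
  have hv0 : v ≠ 0 := by
    rintro rfl
    exact hx.ne rfl
  have hnorm : 0 < ‖v‖⁻¹ := inv_pos.2 (norm_pos_iff.2 hv0)
  exact ⟨v, hvD, ⟨NormedSpace.norm_normalize hv0,
    Cone.smul (v := v.ofLp) ⟨hx.le, hz.le⟩ hnorm.le⟩, mul_pos hnorm hx, hvu⟩

lemma ofLp_wordMap_eq_halfMatrix (r : ℝ) (v : EuclideanSpace ℝ (Fin 3)) :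
    (wordMap (blockMap r) [0, 2, 1, 1, 2, 0, 1, 1] v).ofLp =
      halfMatrix r *ᵥ (halfMatrix r *ᵥ v.ofLp) := by
  simp only [halfMatrix_mulVec_halfMatrix_mulVec, wordMap, ContinuousLinearMap.comp_apply,
    ContinuousLinearMap.id_apply, ofLp_blockMap]

lemma exists_wordMap_expanding_functional (hr : r ∈ Ioo 0 1) (hu : u ∈ sphereCone)
    (h : itinerary (bToB r) (code r) 8 u = [0, 2, 1, 1, 2, 0, 1, 1])
    (hper : (bToB r)^[8] u = u) :
    ∃ φ : EuclideanSpace ℝ (Fin 3) →L[ℝ] ℝ, φ ≠ 0 ∧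
      ∃ σ > ‖wordMap (blockMap r) [0, 2, 1, 1, 2, 0, 1, 1] u‖,
        ∀ v, φ (wordMap (blockMap r) [0, 2, 1, 1, 2, 0, 1, 1] v) = σ * φ v := by
  have hnorm := (isPiecewiseProjective_bToB hr.1).iterate_eq_normalize 8 hu
  rw [hper, h] at hnorm
  set W := wordMap (blockMap r) [0, 2, 1, 1, 2, 0, 1, 1]
  have hWu : W u = ‖W u‖ • u := by
    nth_rw 3 [hnorm]
    exact (NormedSpace.norm_smul_normalize _).symm
  have hW0 : 0 < ‖W u‖ := norm_pos_iff.2 fun h0 => ne_zero_of_mem_sphereCone hu <| by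
    rw [hnorm, h0, NormedSpace.normalize_zero_eq_zero]
  have hW : ∀ v, (W v).ofLp = halfMatrix r *ᵥ (halfMatrix r *ᵥ v.ofLp) :=
    ofLp_wordMap_eq_halfMatrix r
  rw [itinerary_bToB_eq_itinerary_step hr.1 hu] at h
  obtain ⟨σ, hσ, l, hl, hlH⟩ := exists_expanding_functional hr hW0
    (hu.2.mem_admissibleCone hr.1 (l := [1, 2, 0, 1, 1]) h)
    (hu.2.halfMatrix_mulVec_mem_admissibleCone hr.1 h)
    (by rw [← hW, ← WithLp.ofLp_smul, ← hWu])
  have hinner : ∀ v, innerSL ℝ (WithLp.toLp 2 l) v = l ⬝ᵥ v.ofLp := fun v => by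
    rw [innerSL_apply_apply, EuclideanSpace.inner_eq_star_dotProduct, star_trivial, dotProduct_comm]
  refine ⟨innerSL ℝ (WithLp.toLp 2 l), ?_, σ, hσ, fun v => ?_⟩
  · rwa [← norm_ne_zero_iff, innerSL_apply_norm, norm_ne_zero_iff, ne_eq, WithLp.toLp_eq_zero]
  · rw [hinner, hinner, hW, hlH]

lemma exists_escaping (hr : r ∈ Ioo 0 1) (hu : u ∈ sphereCone)
    (h : itinerary (bToB r) (code r) 8 u = [0, 2, 1, 1, 2, 0, 1, 1])
    (hper : (bToB r)^[8] u = u) :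
    ∃ ε > 0, ∀ δ > 0, ∃ v ∈ sphereCone, 0 < v 0 ∧ dist v u < δ ∧
      ¬ ∀ᶠ n in atTop, dist ((bToB r)^[n] v) ((bToB r)^[n] u) < ε := by
  obtain ⟨φ, hφ0, σ, hσ, hφ⟩ := exists_wordMap_expanding_functional hr hu h hper
  have hproj := isPiecewiseProjective_bToB hr.1
  obtain ⟨ε, hε, hesc⟩ := hproj.exists_forall_not_eventually_dist_lt (n := 8) (by lia) hper
    (fun k hk => codeStableAt_iterate_of_itinerary hr hu h hk) (h.symm ▸ hφ)
    (h.symm ▸ hσ.trans_le (le_abs_self σ))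
  refine ⟨ε, hε, fun δ hδ => ?_⟩
  obtain ⟨v, hvφ, hvS, hv0, hvu⟩ := exists_normalize_mem_sphereCone
    (dense_setOf_forall_wordMap_ne_zero (blockMap_surjective hr.1) hφ0) hu hδ
  exact ⟨_, hvS, hv0, hvu, hesc _ hvS (hproj.map_iterate_normalize_ne_zero hvS hvφ)⟩

end Sphere

section Representatives

variable {r ε : ℝ} {u v : EuclideanSpace ℝ (Fin 3)} {n : ℕ}

lemma rep_neg_of_not_cone (hu : Cone u.ofLp) (h : ¬ Cone (-u).ofLp) : rep (-u) = rep u := by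
  rw [rep_of_cone hu]
  exact (if_neg h).trans (by rw [neg_neg])

lemma exists_representative (hu : u ∈ X) :
    ∃ u' ∈ sphereCone, rep u = rep u' ∧ (u = u' ∨ u = -u') := by
  obtain ⟨hn, hu⟩ := hu
  by_cases h : Cone u.ofLp
  · exact ⟨u, ⟨hn, h⟩, rfl, .inl rfl⟩
  · have hneg : Cone (-u).ofLp :=
      (hu.resolve_left h).imp (fun hx => neg_nonneg.2 hx) (fun hz => neg_nonpos.2 hz)
    refine ⟨-u, ⟨by rwa [norm_neg], hneg⟩, ?_, .inr (neg_neg u).symm⟩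
    nth_rw 1 [← neg_neg u]
    exact rep_neg_of_not_cone hneg (by rwa [neg_neg])

lemma mem_X_of_mem_sphereCone (hu : u ∈ sphereCone) : u ∈ X := ⟨hu.1, .inl hu.2⟩

lemma neg_mem_X_of_mem_sphereCone (hu : u ∈ sphereCone) : -u ∈ X :=
  ⟨(norm_neg u).trans hu.1, .inr ⟨neg_nonpos.2 hu.2.1, neg_nonneg.2 hu.2.2⟩⟩

lemma bToB_congr_rep (h : rep u = rep v) : bToB r u = bToB r v := by simp only [bToB, h]

lemma symbol_congr_rep (h : rep u = rep v) : symbol r u = symbol r v := by simp only [symbol, h]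

lemma iterate_succ_bToB_congr_rep (h : rep u = rep v) (n : ℕ) :
    (bToB r)^[n + 1] u = (bToB r)^[n + 1] v := by
  rw [iterate_succ_apply, iterate_succ_apply, bToB_congr_rep h]

lemma itinerary_symbol_congr_rep (h : rep u = rep v) :
    itinerary (bToB r) (symbol r) n u = itinerary (bToB r) (symbol r) n v := by
  cases n with
  | zero => rfl
  | succ n => rw [itinerary_succ, itinerary_succ, symbol_congr_rep h, bToB_congr_rep h]

lemma symbol_eq (hr : 0 < r) (hu : Cone u.ofLp) : symbol r u = (code r u : ℕ) + 1 := by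
  rw [symbol, rep_of_cone hu]
  generalize hs : code r u = s
  match s, hs with
  | 0, hs => simp [bBlock_of_cycle_eq_zero hr hu hs]
  | 1, hs => rcases bBlock_of_cycle_eq_one hs with h | h <;> simp [h]
  | 2, hs => simp [bBlock_of_cycle_eq_two hr hu hs]

lemma itinerary_symbol_eq_map (hr : 0 < r) (hu : u ∈ sphereCone) :
    itinerary (bToB r) (symbol r) n u =
      (itinerary (bToB r) (code r) n u).map fun s : Fin 3 => (s : ℕ) + 1 := by
  rw [itinerary, itinerary, List.map_map]
  exact List.map_congr_left fun k _ =>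
    symbol_eq hr ((isPiecewiseProjective_bToB hr).mapsTo.iterate k hu).2

lemma Generates.itinerary_symbol_eq {w : List ℕ} (h : Generates r w u) :
    itinerary (bToB r) (symbol r) w.length u = w := by
  refine List.ext_getElem (by simp [itinerary]) fun k _ hk => ?_
  simpa [itinerary] using h.1 k hk

lemma Generates.itinerary_code_eq (hr : 0 < r) (hv : v ∈ sphereCone) (hrep : rep u = rep v)
    (h : Generates r [1, 3, 2, 2, 3, 1, 2, 2] u) :
    itinerary (bToB r) (code r) 8 v = [0, 2, 1, 1, 2, 0, 1, 1] := by
  have hinj : Injective fun s : Fin 3 => (s : ℕ) + 1 :=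
    (add_left_injective 1).comp Fin.val_injective
  have hsymbol := h.itinerary_symbol_eq
  rw [itinerary_symbol_congr_rep hrep, itinerary_symbol_eq_map hr hv] at hsymbol
  exact List.map_injective_iff.2 hinj hsymbol

lemma iterate_bToB_ne_neg (hr : r ∈ Ioo 0 1) (hu : u ∈ sphereCone) {l : List (Fin 3)}
    (h : itinerary (bToB r) (code r) (l.length + 2) u = 0 :: 2 :: l) (n : ℕ) :
    (bToB r)^[n] u ≠ -u := by
  intro hneg
  have hcone := ((isPiecewiseProjective_bToB hr.1).mapsTo.iterate n hu).2
  rw [hneg] at hcone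
  rw [itinerary_bToB_eq_itinerary_step hr.1 hu, itinerary_step_succ_eq_cons_iff,
    itinerary_step_succ_eq_cons_iff] at h
  rcases ne_zero_of_cycle_eq_zero_of_cycle_eq_two hr hu.2 h.1 h.2.1 with h0 | h2
  · exact h0 (le_antisymm (neg_nonneg.1 hcone.1) hu.2.1)
  · exact h2 (le_antisymm hu.2.2 (neg_nonpos.1 hcone.2))

lemma Generates.iterate_eq (hr : r ∈ Ioo 0 1) (hv : v ∈ sphereCone) (hrep : rep u = rep v)
    (huv : u = v ∨ u = -v) (h : Generates r [1, 3, 2, 2, 3, 1, 2, 2] u) :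
    (bToB r)^[8] v = v := by
  have hcode := h.itinerary_code_eq hr.1 hv hrep
  have hper : (bToB r)^[8] u = u ∨ (bToB r)^[8] u = -u := h.2
  rw [iterate_succ_bToB_congr_rep hrep] at hper
  have hper' : (bToB r)^[8] v = v ∨ (bToB r)^[8] v = -v := by
    rcases huv with rfl | rfl
    · exact hper
    · rw [neg_neg] at hper
      exact hper.symm
  exact hper'.resolve_right (iterate_bToB_ne_neg hr hv (l := [1, 1, 2, 0, 1, 1]) hcode 8)

lemma exists_eventually_dist_lt_of_stable (h : LyapunovStable r u ∨ LocallyAttracting r u)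
    (hε : 0 < ε) : ∃ δ > 0, ∀ v ∈ X, dist v u < δ →
      ∀ᶠ n in atTop, dist ((bToB r)^[n] v) ((bToB r)^[n] u) < ε := by
  rcases h with h | ⟨δ, hδ, h⟩
  · obtain ⟨δ, hδ, h⟩ := h ε hε
    exact ⟨δ, hδ, fun v hv hd => .of_forall (h v hv hd)⟩
  · exact ⟨δ, hδ, fun v hv hd => (h v hv hd).eventually_lt_const hε⟩

lemma exists_mem_X_rep_eq {u' v' : EuclideanSpace ℝ (Fin 3)} (hv' : v' ∈ sphereCone)
    (hpos : 0 < v' 0) (huu' : u = u' ∨ u = -u') :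
    ∃ v ∈ X, dist v u = dist v' u' ∧ rep v = rep v' := by
  rcases huu' with rfl | rfl
  · exact ⟨v', mem_X_of_mem_sphereCone hv', rfl, rfl⟩
  · exact ⟨-v', neg_mem_X_of_mem_sphereCone hv', dist_neg_neg _ _,
      rep_neg_of_not_cone hv'.2 fun hneg => (neg_nonneg.1 hneg.1).not_gt hpos⟩

lemma eventually_dist_iterate_congr_rep {u' v' : EuclideanSpace ℝ (Fin 3)} (hu : rep u = rep u')
    (hv : rep v = rep v')
    (h : ∀ᶠ n in atTop, dist ((bToB r)^[n] v) ((bToB r)^[n] u) < ε) :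
    ∀ᶠ n in atTop, dist ((bToB r)^[n] v') ((bToB r)^[n] u') < ε := by
  filter_upwards [h, eventually_ne_atTop 0] with n hn hn0
  obtain ⟨n, rfl⟩ := Nat.exists_eq_succ_of_ne_zero hn0
  rwa [iterate_succ_bToB_congr_rep hu, iterate_succ_bToB_congr_rep hv] at hn

end Representatives

end FourParticles

open FourParticles

theorem mainTheorem3 (r : ℝ) (hr : r ∈ Set.Ioo (0 : ℝ) 1) :
    ¬ ∃ u ∈ FourParticles.X, FourParticles.Generates r [1, 3, 2, 2, 3, 1, 2, 2] u ∧
      (FourParticles.LyapunovStable r u ∨ FourParticles.LocallyAttracting r u) := by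
  rintro ⟨u, hu, hgen, hstable⟩
  obtain ⟨u', hu', hrep, huu'⟩ := exists_representative hu
  obtain ⟨ε, hε, hesc⟩ := exists_escaping hr hu' (hgen.itinerary_code_eq hr.1 hu' hrep)
    (hgen.iterate_eq hr hu' hrep huu')
  obtain ⟨δ, hδ, hclose⟩ := exists_eventually_dist_lt_of_stable hstable hε
  obtain ⟨v', hv', hpos, hdist, hnot⟩ := hesc δ hδ
  obtain ⟨v, hv, hvu, hvrep⟩ := exists_mem_X_rep_eq hv' hpos huu'
  exact hnot (eventually_dist_iterate_congr_rep hrep hvrep (hclose v hv (hvu.trans_lt hdist)))
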